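/- Let $(\mathcal X,\mathcal S)$ be a measurable space and let $\mathcal F$ be a family of measurable functions $f:\mathcal X\to\mathbb R$ with envelope $F$, that is, $F:\mathcal X\to[0,\infty)$ is measurable and $|f(x)|\le F(x)$ for all $x\in\mathcal X$ and $f\in\mathcal F$. Suppose that $\mathcal F$ is separable: there is a countable $\mathcal F_0\subseteq\mathcal F$ such that every $f\in\mathcal F$ is the pointwise limit (at every $x \in \mathcal X$) of a sequence of functions in $\mathcal F_0$. For $\alpha\in\mathbb R$ let $\mathcal C_\alpha=\{\{x\in\mathcal X: f(x)\le\alpha\}: f\in\mathcal F\}$, and suppose that for every $\alpha\in\mathbb R$ the Vapnik-Chervonenkis dimension of $\mathcal C_\alpha$ is finite, that is, there is a bound (possibly depending on $\alpha$) on the cardinality of the finite sets $D\subseteq\mathcal X$ all of whose subsets are of the form $C\cap D$ with $C\in\mathcal C_\alpha$. If $\mu$ is any probability measure on $(\mathcal X,\mathcal S)$ such that $\int F\,d\mu<\infty$, then the bracketing number $N_{[\,]}(\epsilon,\mathcal F,\mu)$ is finite for every $\epsilon>0$. Here $N_{[\,]}(\epsilon,\mathcal F,\mu)$ is the least number of $\epsilon$-brackets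 needed to cover $\mathcal F$, where an $\epsilon$-bracket is a set $[g,h]=\{f \text{ measurable}: g\le f\le h \text{ pointwise on } \mathcal X\}$ with $g\le h$ measurable real-valued functions on $\mathcal X$ such that $\int(h-g)\,d\mu\le\epsilon$. -/

import Mathlib

open MeasureTheory Filter Topology
open scoped ENNReal

namespace VCBracketing

/-- A family of sets `𝒞` shatters the finite set `D` if every subset of `D` has the form
`C ∩ D` with `C ∈ 𝒞`. -/
def Shatters {X : Type*} (𝒞 : Set (Set X)) (D : Finset X) : Prop :=
  ∀ T : Set X, T ⊆ (D : Set X) → ∃ C ∈ 𝒞, C ∩ (D : Set X) = T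

/-- The Vapnik-Chervonenkis dimension of a family of sets: the largest cardinality of a finite
set shattered by the family, `⊤` if arbitrarily large finite sets are shattered. -/
noncomputable def vcDim {X : Type*} (𝒞 : Set (Set X)) : ℕ∞ :=
  ⨆ D ∈ {D : Finset X | Shatters 𝒞 D}, (D.card : ℕ∞)

/-- The family of `α`-level sets `{x | f x ≤ α}`, for `f ∈ ℱ`. -/
def levelSets {X : Type*} (ℱ : Set (X → ℝ)) (α : ℝ) : Set (Set X) :=
  {L | ∃ f ∈ ℱ, L = {x | f x ≤ α}}

/-- `F` is an envelope for `ℱ`: a measurable function with values in `[0, ∞)` such that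
`|f x| ≤ F x` for all `x` and all `f ∈ ℱ`. -/
structure IsEnvelope {X : Type*} [MeasurableSpace X] (F : X → ℝ) (ℱ : Set (X → ℝ)) : Prop where
  measurable : Measurable F
  nonneg : ∀ x, 0 ≤ F x
  abs_le : ∀ f ∈ ℱ, ∀ x, |f x| ≤ F x

/-- `ℱ` is separable: there is a countable sub-family such that every member of `ℱ` is the
pointwise (everywhere) limit of a sequence of members of the sub-family. -/
def IsSeparableFamily {X : Type*} (ℱ : Set (X → ℝ)) : Prop :=
  ∃ ℱ₀ ⊆ ℱ, ℱ₀.Countable ∧ ∀ f ∈ ℱ, ∃ u : ℕ → X → ℝ,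
    (∀ n, u n ∈ ℱ₀) ∧ ∀ x, Tendsto (fun n => u n x) atTop (𝓝 (f x))

/-- The bracket `[g, h]`: all measurable functions lying pointwise between `g` and `h`. -/
def bracket {X : Type*} [MeasurableSpace X] (g h : X → ℝ) : Set (X → ℝ) :=
  {f | Measurable f ∧ g ≤ f ∧ f ≤ h}

/-- The pair `(g, h)` are the end points of an `ε`-bracket: `g ≤ h` are measurable real-valued
functions with `∫ (h - g) dμ ≤ ε`. As `h - g ≥ 0`, the integral is taken in `[0, ∞]`. -/
structure IsEpsBracket {X : Type*} [MeasurableSpace X] (μ : Measure X) (ε : ℝ)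
    (p : (X → ℝ) × (X → ℝ)) : Prop where
  measurable_fst : Measurable p.1
  measurable_snd : Measurable p.2
  le : p.1 ≤ p.2
  lintegral_le : ∫⁻ x, ENNReal.ofReal (p.2 x - p.1 x) ∂μ ≤ ENNReal.ofReal ε

/-- A collection of `ε`-brackets (given by their end points) covering `ℱ`. -/
def IsBracketCover {X : Type*} [MeasurableSpace X] (ε : ℝ) (ℱ : Set (X → ℝ)) (μ : Measure X)
    (Θ : Set ((X → ℝ) × (X → ℝ))) : Prop :=
  (∀ p ∈ Θ, IsEpsBracket μ ε p) ∧ ℱ ⊆ ⋃ p ∈ Θ, bracket p.1 p.2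

/-- The bracketing number: the least number of `ε`-brackets needed to cover `ℱ`, `⊤` if no
finite collection of `ε`-brackets covers `ℱ`. -/
noncomputable def bracketingNumber {X : Type*} [MeasurableSpace X] (ε : ℝ) (ℱ : Set (X → ℝ))
    (μ : Measure X) : ℕ∞ :=
  ⨅ Θ ∈ {Θ | IsBracketCover ε ℱ μ Θ}, Θ.encard

end VCBracketing

/-! Call the boundary of `C` for a finite partition the union of the cells that `C` splits into two
non-null parts. For a class of finite VC dimension some partition makes all boundaries uniformly
small (`exists_forall_measure_boundary_le`). Otherwise bad sets `C π` along ever finer partitions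
concentrate on a non-null `E`, all of whose non-null measurable subsets get split, finitely many at
a time. Iterating this yields arbitrarily many independent members of the class, contradicting
finite dimension by duality.

Apply this to the levels `k * η`, `|k| ≤ K`, with `η = ε / 2`. Members of the countable subfamily
are grouped by the finitely many signatures. Within a group the oscillation is a.e. at most `η` off
a small set, where `2 * F` has small integral, so the infimum and supremum of a group form an
`ε`-bracket. Pointwise limits stay in these brackets. -/

namespace VCBracketing

/-! ### Finite partitions and boundaries -/

/-- The label of a point in the partition generated by a finite set of measurable sets. -/
def label {X : Type*} [MeasurableSpace X] (π : Finset {S : Set X // MeasurableSet S}) (x : X) :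
    π → Prop :=
  fun S => x ∈ S.1.1

/-- The cell of the partition generated by `π` with a given label. -/
def cell {X : Type*} [MeasurableSpace X] (π : Finset {S : Set X // MeasurableSet S})
    (a : π → Prop) : Set X :=
  label π ⁻¹' {a}

/-- The union of the cells that `C` splits into two parts of positive measure. -/
def boundary {X : Type*} [MeasurableSpace X] (μ : Measure X)
    (π : Finset {S : Set X // MeasurableSet S}) (C : Set X) : Set X :=
  {x | μ (cell π (label π x) ∩ C) ≠ 0 ∧ μ (cell π (label π x) \ C) ≠ 0}

section

variable {X : Type*} [MeasurableSpace X] {μ : Measure X}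

lemma measurable_label (π : Finset {S : Set X // MeasurableSet S}) : Measurable (label π) := by
  refine measurable_pi_iff.2 fun S => ?_
  exact S.1.2.mem

lemma measurableSet_boundary (π : Finset {S : Set X // MeasurableSet S}) (C : Set X) :
    MeasurableSet (boundary μ π C) := by
  have : boundary μ π C
      = label π ⁻¹' {a | μ (cell π a ∩ C) ≠ 0 ∧ μ (cell π a \ C) ≠ 0} := rfl
  rw [this]
  exact measurable_label π (Set.toFinite _).measurableSet

lemma cell_label_subset_of_le {π π' : Finset {S : Set X // MeasurableSet S}} (h : π ≤ π') (x : X) :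
    cell π' (label π' x) ⊆ cell π (label π x) := by
  intro y hy
  have hy' : label π' y = label π' x := hy
  change label π y = label π x
  funext S
  exact congrFun hy' ⟨S.1, h S.2⟩

lemma cell_label_subset_of_mem {π : Finset {S : Set X // MeasurableSet S}}
    {A : {S : Set X // MeasurableSet S}} (h : A ∈ π) {x : X} (hx : x ∈ A.1) :
    cell π (label π x) ⊆ A.1 := by
  intro y hy
  have hy' : label π y = label π x := hy
  exact (congrFun hy' ⟨A, h⟩).mpr hx

lemma boundary_anti {π π' : Finset {S : Set X // MeasurableSet S}} (h : π ≤ π') (C : Set X) :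
    boundary μ π' C ⊆ boundary μ π C := by
  intro x hx
  have hs := cell_label_subset_of_le h x
  exact ⟨fun h0 => hx.1 (measure_mono_null (Set.inter_subset_inter_left _ hs) h0),
    fun h0 => hx.2 (measure_mono_null (Set.sdiff_subset_sdiff_left hs) h0)⟩

/-- There are finitely many cells, so one null set serves them all before the label is made to
depend on `x`. -/
lemma ae_cell_label (π : Finset {S : Set X // MeasurableSet S}) (B : Set X) :
    ∀ᵐ x ∂μ, μ (cell π (label π x) ∩ B) = 0 → x ∉ B := by
  have : ∀ᵐ x ∂μ, ∀ a, μ (cell π a ∩ B) = 0 → x ∉ cell π a ∩ B := by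
    refine ae_all_iff.2 fun a => ?_
    by_cases h : μ (cell π a ∩ B) = 0
    · filter_upwards [measure_eq_zero_iff_ae_notMem.1 h] with x hx _ using hx
    · exact Eventually.of_forall fun x h' => absurd h' h
  filter_upwards [this] with x hx h0 hB
  exact hx _ h0 ⟨rfl, hB⟩

/-! ### Exhaustion, independence and duality -/

/-- Exhaustion: if the traces of the sets `B i` do not become negligible on the whole space, then
there is a non-null set on whose non-null measurable subsets no trace becomes negligible. -/
lemma exists_forall_subset_not_tendsto_zero {ι : Type*} (l : Filter ι) [IsProbabilityMeasure μ]
    (B : ι → Set X) (hB : ¬ Tendsto (fun i => μ (B i)) l (𝓝 0)) :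
    ∃ E, MeasurableSet E ∧ μ E ≠ 0 ∧ ∀ A ⊆ E, MeasurableSet A → μ A ≠ 0 →
      ¬ Tendsto (fun i => μ (B i ∩ A)) l (𝓝 0) := by
  classical
  set N : Set (Set X) := {A | MeasurableSet A ∧ Tendsto (fun i => μ (B i ∩ A)) l (𝓝 0)} with hN
  have hunion : ∀ A₁ ∈ N, ∀ A₂ ∈ N, A₁ ∪ A₂ ∈ N := by
    rintro A₁ ⟨hm₁, h₁⟩ A₂ ⟨hm₂, h₂⟩
    refine ⟨hm₁.union hm₂, ?_⟩
    have := h₁.add h₂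
    rw [add_zero] at this
    refine tendsto_of_tendsto_of_tendsto_of_le_of_le tendsto_const_nhds this
      (fun _ => zero_le) fun i => ?_
    simp only [Set.inter_union_distrib_left]
    exact measure_union_le _ _
  have hnull : ∀ A, MeasurableSet A → μ A = 0 → A ∈ N := by
    intro A hA h0
    refine ⟨hA, ?_⟩
    have : ∀ i, μ (B i ∩ A) = 0 := fun i => measure_mono_null Set.inter_subset_right h0
    simp only [this]
    exact tendsto_const_nhds
  have hiUnion : ∀ A : ℕ → Set X, (∀ n, A n ∈ N) → (⋃ n, A n) ∈ N := by
    intro A hA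
    have hacc : ∀ n, Set.accumulate A n ∈ N := by
      intro n
      induction n with
      | zero => simpa [Set.accumulate_zero_nat] using hA 0
      | succ n ih => rw [Set.accumulate_succ]; exact hunion _ ih _ (hA _)
    have hm : MeasurableSet (⋃ n, A n) := MeasurableSet.iUnion fun n => (hA n).1
    refine ⟨hm, ENNReal.tendsto_nhds_zero.2 fun δ hδ => ?_⟩
    have hδ2 : 0 < δ / 2 := ENNReal.half_pos hδ.ne'
    -- The tail beyond finitely many sets is small uniformly in `i`.
    have hlim : Tendsto (fun n => μ ((⋃ n, A n) \ Set.accumulate A n)) atTop (𝓝 0) := by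
      have := tendsto_measure_iInter_atTop (μ := μ)
        (s := fun n => (⋃ n, A n) \ Set.accumulate A n)
        (fun n => (hm.diff (hacc n).1).nullMeasurableSet)
        (fun m n hmn => Set.sdiff_subset_sdiff_right (Set.monotone_accumulate hmn))
        ⟨0, measure_ne_top _ _⟩
      have he : (⋂ n, (⋃ n, A n) \ Set.accumulate A n) = ∅ := by
        rw [← Set.sdiff_iUnion, Set.iUnion_accumulate, Set.sdiff_self]
      rwa [he, measure_empty] at this
    obtain ⟨n, hn⟩ := ((ENNReal.tendsto_nhds_zero.1 hlim) _ hδ2).exists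
    filter_upwards [ENNReal.tendsto_nhds_zero.1 (hacc n).2 _ hδ2] with i hi
    calc μ (B i ∩ ⋃ n, A n)
        ≤ μ ((B i ∩ Set.accumulate A n) ∪ ((⋃ n, A n) \ Set.accumulate A n)) := by
          refine measure_mono fun x hx => ?_
          by_cases h : x ∈ Set.accumulate A n
          · exact Or.inl ⟨hx.1, h⟩
          · exact Or.inr ⟨hx.2, h⟩
      _ ≤ _ := measure_union_le _ _
      _ ≤ δ / 2 + δ / 2 := add_le_add hi hn
      _ = δ := ENNReal.add_halves δ
  have hne : (μ '' N).Nonempty := ⟨_, ∅, hnull _ MeasurableSet.empty measure_empty, rfl⟩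
  -- The union of a maximizing sequence has maximal measure in `N`; `E` is its complement.
  obtain ⟨v, -, hv, hvN⟩ := exists_seq_tendsto_sSup hne (OrderTop.bddAbove _)
  choose A hAN hA using hvN
  have hU := hiUnion A hAN
  have hmax : sSup (μ '' N) ≤ μ (⋃ n, A n) :=
    le_of_tendsto' hv fun n => hA n ▸ measure_mono (Set.subset_iUnion A n)
  have hkey : ∀ A' ⊆ (⋃ n, A n)ᶜ, A' ∈ N → μ A' = 0 := by
    intro A' hsub hA'
    have h1 : μ ((⋃ n, A n) ∪ A') ≤ μ (⋃ n, A n) :=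
      (le_sSup (Set.mem_image_of_mem μ (hunion _ hU _ hA'))).trans hmax
    rw [measure_union (Set.disjoint_left.2 fun x hx hx' => hsub hx' hx) hA'.1] at h1
    have h2 : μ (⋃ n, A n) + μ A' ≤ μ (⋃ n, A n) + 0 := by simpa using h1
    exact le_zero_iff.1 ((ENNReal.add_le_add_iff_left (measure_ne_top _ _)).1 h2)
  refine ⟨(⋃ n, A n)ᶜ, hU.1.compl, fun h0 => hB ?_, fun A' hsub hA' hpos ht =>
    hpos (hkey A' hsub ⟨hA', ht⟩)⟩
  have := (hunion _ hU _ (hnull _ hU.1.compl h0)).2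
  simpa only [Set.union_compl_self, Set.inter_univ] using this

/-- A family of sets of unbounded dual dimension has infinite Vapnik-Chervonenkis dimension. -/
lemma vcDim_eq_top_of_dual {X : Type*} {𝒞 : Set (Set X)}
    (h : ∀ L : ℕ, ∃ C : Fin L → Set X, (∀ i, C i ∈ 𝒞) ∧
      ∀ s : Fin L → Prop, ∃ x, ∀ i, x ∈ C i ↔ s i) : vcDim 𝒞 = ⊤ := by
  classical
  refine ENat.eq_top_iff_forall_ge.2 fun k => ?_
  -- Index `2 ^ k` sets by the subsets of `Fin k`; the point `x i` lies in exactly those indexed by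
  -- subsets containing `i`.
  let e := Fintype.equivFin (Set (Fin k))
  obtain ⟨C, hC, hx⟩ := h (Fintype.card (Set (Fin k)))
  choose x hx using fun i : Fin k => hx fun t => i ∈ e.symm t
  have hxe : ∀ i T, x i ∈ C (e T) ↔ i ∈ T := fun i T => by rw [hx, e.symm_apply_apply]
  have hinj : Function.Injective x := by
    intro i j hij
    have h1 := (hxe i {i}).2 rfl
    rw [hij, hxe] at h1
    exact h1.symm
  have hsh : Shatters 𝒞 (Finset.univ.map ⟨x, hinj⟩) := by
    intro T hT
    refine ⟨C (e (x ⁻¹' T)), hC _, ?_⟩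
    ext y
    constructor
    · rintro ⟨h1, h2⟩
      obtain ⟨i, -, rfl⟩ := Finset.mem_map.1 (Finset.mem_coe.1 h2)
      exact (hxe i _).1 h1
    · intro hy
      have h2 := hT hy
      refine ⟨?_, h2⟩
      obtain ⟨i, -, rfl⟩ := Finset.mem_map.1 (Finset.mem_coe.1 h2)
      exact (hxe i _).2 hy
  have := le_iSup₂ (f := fun (D : Finset X) (_ : D ∈ {D : Finset X | Shatters 𝒞 D}) =>
    (D.card : ℕ∞)) _ hsh
  simpa [vcDim] using this

/-- If finitely many non-null subsets of a non-null set can always be split simultaneously by a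
member of `𝒞`, then `𝒞` contains arbitrarily long sequences in general position. -/
lemma exists_independent_of_split {𝒞 : Set (Set X)} (hmeas : ∀ C ∈ 𝒞, MeasurableSet C)
    {E : Set X} (hE : MeasurableSet E) (hE0 : μ E ≠ 0)
    (hsplit : ∀ (ι : Type) [Finite ι] (A : ι → Set X), (∀ i, A i ⊆ E ∧ MeasurableSet (A i) ∧
      μ (A i) ≠ 0) → ∃ C ∈ 𝒞, ∀ i, μ (A i ∩ C) ≠ 0 ∧ μ (A i \ C) ≠ 0) (L : ℕ) :
    ∃ C : Fin L → Set X, (∀ i, C i ∈ 𝒞) ∧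
      ∀ s : Fin L → Prop, μ {x ∈ E | ∀ i, x ∈ C i ↔ s i} ≠ 0 := by
  classical
  induction L with
  | zero => exact ⟨Fin.elim0, fun i => i.elim0, fun s => by simpa using hE0⟩
  | succ L ih =>
    obtain ⟨C, hC, hs⟩ := ih
    -- Split all `2 ^ L` Venn regions in `E` at once.
    obtain ⟨C₀, hC₀, h₀⟩ := hsplit (Fin L → Prop) (fun s => {x ∈ E | ∀ i, x ∈ C i ↔ s i})
      fun s => ⟨Set.sep_subset _ _, by
        refine hE.inter (?_ : MeasurableSet {x | ∀ i, x ∈ C i ↔ s i})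
        rw [Set.ofPred_forall]
        refine MeasurableSet.iInter fun i => ?_
        by_cases hsi : s i
        · simp only [hsi, iff_true]
          exact hmeas _ (hC i)
        · simp only [hsi, iff_false]
          exact (hmeas _ (hC i)).compl, hs s⟩
    refine ⟨Fin.cons C₀ C, Fin.cases hC₀ hC, fun s => ?_⟩
    by_cases hs0 : s 0
    · convert (h₀ fun i => s i.succ).1 using 2
      ext x
      simp only [Set.mem_ofPred_eq, Fin.forall_fin_succ, Fin.cons_zero, Fin.cons_succ, hs0,
        Set.mem_inter_iff]
      tauto
    · convert (h₀ fun i => s i.succ).2 using 2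
      ext x
      simp only [Set.mem_ofPred_eq, Fin.forall_fin_succ, Fin.cons_zero, Fin.cons_succ, hs0,
        Set.mem_sdiff]
      tauto

/-- A family of measurable sets of finite Vapnik-Chervonenkis dimension is uniformly approximated
by a finite measurable partition. -/
theorem exists_forall_measure_boundary_le [IsProbabilityMeasure μ] {𝒞 : Set (Set X)}
    (hmeas : ∀ C ∈ 𝒞, MeasurableSet C) (hdim : vcDim 𝒞 < ⊤) {ε : ℝ≥0∞} (hε : ε ≠ 0) :
    ∃ π, ∀ C ∈ 𝒞, μ (boundary μ π C) ≤ ε := by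
  classical
  by_contra! hcon
  choose C hC hCε using hcon
  -- Along an ultrafilter, "not eventually null" becomes "eventually non-null", so finitely many `A
  -- i` can be handled by one `π`.
  let U : Ultrafilter (Finset {S : Set X // MeasurableSet S}) := Ultrafilter.of atTop
  have hU : (U : Filter (Finset {S : Set X // MeasurableSet S})) ≤ atTop := Ultrafilter.of_le _
  obtain ⟨E, hE, hE0, hsub⟩ := exists_forall_subset_not_tendsto_zero (μ := μ) (U : Filter _)
    (fun π => boundary μ π (C π)) fun ht => by
      obtain ⟨π, hπ⟩ := (ENNReal.tendsto_nhds_zero.1 ht ε (pos_iff_ne_zero.2 hε)).exists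
      exact absurd (hCε π) hπ.not_gt
  refine hdim.ne (vcDim_eq_top_of_dual fun L => ?_)
  obtain ⟨D, hD, hs⟩ := exists_independent_of_split (μ := μ) hmeas hE hE0 (fun ι _ A hA => by
    have hev : ∀ᶠ π in (U : Filter _), ∀ i,
        μ (A i ∩ C π) ≠ 0 ∧ μ (A i \ C π) ≠ 0 := by
      refine eventually_all.2 fun i => ?_
      have hnt := hsub (A i) (hA i).1 (hA i).2.1 (hA i).2.2
      have hpos : ∀ᶠ π in (U : Filter _), μ (boundary μ π (C π) ∩ A i) ≠ 0 := by
        refine Ultrafilter.eventually_not.2 fun h0 => hnt ?_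
        exact tendsto_const_nhds.congr' (h0.mono fun _ h => h.symm)
      -- Once `A i ∈ π`, a split cell meeting `A i` lies inside it, so `A i` is split too.
      filter_upwards [hpos, hU (eventually_ge_atTop {⟨A i, (hA i).2.1⟩})] with π h1 h2
      obtain ⟨x, hx, hxA⟩ := nonempty_of_measure_ne_zero h1
      have hs := cell_label_subset_of_mem (Finset.singleton_subset_iff.1 h2) hxA
      exact ⟨fun h0 => hx.1 (measure_mono_null (Set.inter_subset_inter_left _ hs) h0),
        fun h0 => hx.2 (measure_mono_null (Set.sdiff_subset_sdiff_left hs) h0)⟩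
    obtain ⟨π, hπ⟩ := hev.exists
    exact ⟨C π, hC π, hπ⟩) L
  refine ⟨D, hD, fun s => ?_⟩
  obtain ⟨x, -, hx⟩ := nonempty_of_measure_ne_zero (hs s)
  exact ⟨x, hx⟩

/-! ### Signatures and brackets -/

/-- The labels of the cells on which `f` is almost surely above, respectively at most, the levels
`k * η` with `|k| ≤ K`. -/
def signature (μ : Measure X) (π : Finset {S : Set X // MeasurableSet S}) (η : ℝ) (K : ℕ)
    (f : X → ℝ) (k : Finset.Icc (-(K : ℤ)) K) (a : π → Prop) : Prop × Prop :=
  (μ (cell π a ∩ {x | f x ≤ k * η}) = 0, μ (cell π a \ {x | f x ≤ k * η}) = 0)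

lemma abs_sub_le_of_forall_le_iff {η a b : ℝ} (hη : 0 < η) {K : ℕ} (ha : |a| ≤ K * η)
    (hb : |b| ≤ K * η)
    (h : ∀ k : ℤ, k ∈ Finset.Icc (-(K : ℤ)) K → (a ≤ k * η ↔ b ≤ k * η)) : b - a ≤ η := by
  by_contra! hlt
  rw [abs_le] at ha hb
  -- This is the largest grid level strictly below `b`; a gap above `η` puts `a` at or below it.
  have h1 : ((⌈b / η⌉ - 1 : ℤ) : ℝ) * η < b := by
    rw [← lt_div_iff₀ hη]
    push_cast
    linarith [Int.ceil_lt_add_one (b / η)]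
  have h2 : a ≤ ((⌈b / η⌉ - 1 : ℤ) : ℝ) * η := by
    have := (div_le_iff₀ hη).1 (Int.le_ceil (b / η))
    push_cast
    linarith
  have hk : ⌈b / η⌉ - 1 ∈ Finset.Icc (-(K : ℤ)) K := by
    rw [Finset.mem_Icc]
    constructor
    · have : (-(K : ℝ)) * η ≤ ((⌈b / η⌉ - 1 : ℤ) : ℝ) * η := by linarith
      exact_mod_cast le_of_mul_le_mul_right this hη
    · have : ((⌈b / η⌉ - 1 : ℤ) : ℝ) * η ≤ (K : ℝ) * η := by linarith
      exact_mod_cast le_of_mul_le_mul_right this hη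
  exact absurd ((h _ hk).1 h2) h1.not_ge

/-- Outside the boundaries and the set of large values of the envelope, functions with the same
signature are close. -/
lemma ae_sub_le_of_signature_eq {𝒢 : Set (X → ℝ)} (hc : 𝒢.Countable) {F : X → ℝ}
    (hF : ∀ f ∈ 𝒢, ∀ x, |f x| ≤ F x) (π : Finset {S : Set X // MeasurableSet S}) {η : ℝ}
    (hη : 0 < η) (K : ℕ) {f₀ : X → ℝ}
    (hsig : ∀ f ∈ 𝒢, signature μ π η K f = signature μ π η K f₀) :
    ∀ᵐ x ∂μ, F x ≤ K * η →
      (∀ k ∈ Finset.Icc (-(K : ℤ)) K, x ∉ boundary μ π {y | f₀ y ≤ k * η}) →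
      ∀ f ∈ 𝒢, ∀ f' ∈ 𝒢, f' x - f x ≤ η := by
  have hae : ∀ᵐ x ∂μ, ∀ f ∈ 𝒢, ∀ k : ℤ,
      (μ (cell π (label π x) ∩ {y | f y ≤ k * η}) = 0 → ¬ f x ≤ k * η) ∧
      (μ (cell π (label π x) \ {y | f y ≤ k * η}) = 0 → f x ≤ k * η) := by
    refine (ae_ball_iff hc).2 fun f _ => ae_all_iff.2 fun k => ?_
    filter_upwards [ae_cell_label (μ := μ) π {y | f y ≤ k * η},
      ae_cell_label (μ := μ) π {y | f y ≤ k * η}ᶜ] with x h1 h2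
    exact ⟨h1, fun h => not_not.1 (h2 h)⟩
  filter_upwards [hae] with x hx hFx hb
  have hiff : ∀ f ∈ 𝒢, ∀ k : ℤ, k ∈ Finset.Icc (-(K : ℤ)) K →
      (f x ≤ k * η ↔ μ (cell π (label π x) \ {y | f₀ y ≤ k * η}) = 0) := by
    intro f hf k hk
    have hs := congrFun (congrFun (hsig f hf) ⟨k, hk⟩) (label π x)
    simp only [signature, Prod.mk.injEq] at hs
    have hbk := hb k hk
    simp only [boundary, Set.mem_ofPred_eq, not_and_or, not_not] at hbk
    constructor
    · intro hle
      exact hbk.resolve_left fun h0 => (hx f hf k).1 (hs.1.mpr h0) hle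
    · intro h0
      exact (hx f hf k).2 (hs.2.mpr h0)
  intro f hf f' hf'
  exact abs_sub_le_of_forall_le_iff hη ((hF f hf x).trans hFx) ((hF f' hf' x).trans hFx)
    fun k hk => (hiff f hf k hk).trans (hiff f' hf' k hk).symm

lemma IsEnvelope.bddBelow {F : X → ℝ} {𝒢 : Set (X → ℝ)} (hF : IsEnvelope F 𝒢) (x : X) :
    BddBelow (Set.range fun f : 𝒢 => f.1 x) := by
  refine ⟨-F x, ?_⟩
  rintro _ ⟨f, rfl⟩
  exact (_root_.abs_le.1 (hF.abs_le f.1 f.2 x)).1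

lemma IsEnvelope.bddAbove {F : X → ℝ} {𝒢 : Set (X → ℝ)} (hF : IsEnvelope F 𝒢) (x : X) :
    BddAbove (Set.range fun f : 𝒢 => f.1 x) := by
  refine ⟨F x, ?_⟩
  rintro _ ⟨f, rfl⟩
  exact (_root_.abs_le.1 (hF.abs_le f.1 f.2 x)).2

/-- The pointwise infimum and supremum of a countable family with the same signature form a
bracket. -/
lemma isEpsBracket_iInf_iSup [IsProbabilityMeasure μ] {𝒢 : Set (X → ℝ)} (hc : 𝒢.Countable)
    (hm : ∀ f ∈ 𝒢, Measurable f) {F : X → ℝ} (hF : IsEnvelope F 𝒢)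
    (π : Finset {S : Set X // MeasurableSet S}) {η ε : ℝ} (hη : 0 < η) (K : ℕ) {f₀ : X → ℝ}
    (hf₀ : f₀ ∈ 𝒢) (hsig : ∀ f ∈ 𝒢, signature μ π η K f = signature μ π η K f₀)
    (hsmall : ENNReal.ofReal η + ∫⁻ x in {x | K * η < F x} ∪
      ⋃ k ∈ Finset.Icc (-(K : ℤ)) K, boundary μ π {y | f₀ y ≤ k * η},
        ENNReal.ofReal (2 * F x) ∂μ ≤ ENNReal.ofReal ε) :
    IsEpsBracket μ ε (fun x => ⨅ f : 𝒢, f.1 x, fun x => ⨆ f : 𝒢, f.1 x) := by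
  have := hc.to_subtype
  have : Nonempty 𝒢 := ⟨⟨f₀, hf₀⟩⟩
  refine ⟨Measurable.iInf fun f => hm f.1 f.2, Measurable.iSup fun f => hm f.1 f.2, fun x =>
    (ciInf_le (hF.bddBelow x) ⟨f₀, hf₀⟩).trans (le_ciSup (hF.bddAbove x) ⟨f₀, hf₀⟩), ?_⟩
  set B : Set X := {x | K * η < F x} ∪
      ⋃ k ∈ Finset.Icc (-(K : ℤ)) K, boundary μ π {y | f₀ y ≤ k * η} with hB
  have hBm : MeasurableSet B :=
    (measurableSet_lt measurable_const hF.measurable).union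
      (Finset.measurableSet_biUnion _ fun k _ => measurableSet_boundary π _)
  have hsub : ∀ x c, (∀ f ∈ 𝒢, ∀ f' ∈ 𝒢, f' x - f x ≤ c) →
      (⨆ f : 𝒢, f.1 x) - (⨅ f : 𝒢, f.1 x) ≤ c := by
    intro x c h
    rw [sub_le_iff_le_add]
    refine ciSup_le fun f' => ?_
    rw [← sub_le_iff_le_add']
    refine le_ciInf fun f => ?_
    linarith [h f.1 f.2 f'.1 f'.2]
  refine le_trans ?_ hsmall
  calc ∫⁻ x, ENNReal.ofReal ((⨆ f : 𝒢, f.1 x) - (⨅ f : 𝒢, f.1 x)) ∂μ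
      ≤ ∫⁻ x, (ENNReal.ofReal η + B.indicator (fun x => ENNReal.ofReal (2 * F x)) x) ∂μ := by
        refine lintegral_mono_ae ?_
        filter_upwards [ae_sub_le_of_signature_eq (μ := μ) hc hF.abs_le π hη K hsig] with x hx
        by_cases hxB : x ∈ B
        · rw [Set.indicator_of_mem hxB]
          refine le_add_left (ENNReal.ofReal_le_ofReal (hsub x _ fun f hf f' hf' => ?_))
          linarith [(abs_le.1 (hF.abs_le f hf x)).1, (abs_le.1 (hF.abs_le f' hf' x)).2]
        · rw [hB] at hxB
          simp only [Set.mem_union, Set.mem_ofPred_eq, Set.mem_iUnion, not_or, not_lt,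
            not_exists] at hxB
          exact le_add_right (ENNReal.ofReal_le_ofReal (hsub x _ (hx hxB.1 hxB.2)))
    _ = _ := by
        rw [lintegral_add_left measurable_const, lintegral_indicator hBm]
        simp

/-- For some finite partition, the boundaries of the level sets at finitely many grid levels are
uniformly small. -/
lemma exists_forall_measure_biUnion_boundary_lt [IsProbabilityMeasure μ] {ℱ : Set (X → ℝ)}
    (hmeas : ∀ f ∈ ℱ, Measurable f) (hdim : ∀ α : ℝ, vcDim (levelSets ℱ α) < ⊤) (η : ℝ)
    (s : Finset ℤ) {δ : ℝ≥0∞} (hδ : δ ≠ 0) :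
    ∃ π, ∀ f ∈ ℱ, μ (⋃ k ∈ s, boundary μ π {y | f y ≤ k * η}) < δ := by
  classical
  -- Each level gets its own share of `δ`; the common refinement then serves all levels.
  obtain ⟨δ', hδ'0, hδ'⟩ := ENNReal.exists_pos_sum_of_countable' hδ ℤ
  have hlev : ∀ k : ℤ, ∃ π, ∀ C ∈ levelSets ℱ (k * η), μ (boundary μ π C) ≤ δ' k := by
    intro k
    refine exists_forall_measure_boundary_le ?_ (hdim _) (hδ'0 k).ne'
    rintro _ ⟨f, hf, rfl⟩
    exact measurableSet_le (hmeas f hf) measurable_const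
  choose π hπ using hlev
  refine ⟨s.sup π, fun f hf => lt_of_le_of_lt ?_ hδ'⟩
  calc _ ≤ ∑ k ∈ s, μ (boundary μ (s.sup π) {y | f y ≤ k * η}) := measure_biUnion_finset_le _ _
    _ ≤ ∑ k ∈ s, δ' k := Finset.sum_le_sum fun k hk =>
        (measure_mono (boundary_anti (Finset.le_sup hk) _)).trans (hπ k _ ⟨f, hf, rfl⟩)
    _ ≤ _ := ENNReal.sum_le_tsum s

lemma exists_measure_lt_of_mul_lt [IsProbabilityMeasure μ] {F : X → ℝ} (hF : Measurable F)
    {η : ℝ} (hη : 0 < η) {δ : ℝ≥0∞} (hδ : δ ≠ 0) : ∃ K : ℕ, μ {x | K * η < F x} < δ := by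
  have hlim := tendsto_measure_iInter_atTop (μ := μ) (s := fun K : ℕ => {x | K * η < F x})
    (fun K => (measurableSet_lt measurable_const hF).nullMeasurableSet)
    (fun m n hmn x hx => lt_of_le_of_lt (by gcongr) (Set.mem_ofPred_eq ▸ hx))
    ⟨0, measure_ne_top _ _⟩
  have he : (⋂ K : ℕ, {x | K * η < F x}) = ∅ := by
    refine Set.eq_empty_of_forall_notMem fun x hx => ?_
    obtain ⟨K, hK⟩ := exists_nat_ge (F x / η)
    exact absurd (Set.mem_iInter.1 hx K) (not_lt.2 ((div_le_iff₀ hη).1 hK))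
  rw [he, measure_empty] at hlim
  exact (hlim.eventually_lt_const (pos_iff_ne_zero.2 hδ)).exists

end

end VCBracketing

open VCBracketing in
theorem proposition1 {X : Type*} [MeasurableSpace X] (ℱ : Set (X → ℝ)) (F : X → ℝ)
    (hmeas : ∀ f ∈ ℱ, Measurable f)
    (hF : VCBracketing.IsEnvelope F ℱ)
    (hsep : VCBracketing.IsSeparableFamily ℱ)
    (hdim : ∀ α : ℝ, VCBracketing.vcDim (VCBracketing.levelSets ℱ α) < ⊤)
    (μ : Measure X) [IsProbabilityMeasure μ]
    (hint : Integrable F μ)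
    (ε : ℝ) (hε : 0 < ε) :
    VCBracketing.bracketingNumber ε ℱ μ < ⊤ := by
  classical
  obtain ⟨ℱ₀, hsub, hcount, happ⟩ := hsep
  have hη : 0 < ε / 2 := half_pos hε
  have hfin : ∫⁻ x, ENNReal.ofReal (2 * F x) ∂μ ≠ ⊤ :=
    (hint.const_mul 2).lintegral_lt_top.ne
  obtain ⟨δ, hδ, hδint⟩ := exists_pos_setLIntegral_lt_of_measure_lt hfin
    (ENNReal.ofReal_pos.2 hη).ne'
  have hδ2 : δ / 2 ≠ 0 := (ENNReal.half_pos hδ.ne').ne'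
  obtain ⟨K, hK⟩ := exists_measure_lt_of_mul_lt (μ := μ) hF.measurable hη hδ2
  obtain ⟨π, hπ⟩ := exists_forall_measure_biUnion_boundary_lt (μ := μ) hmeas hdim (ε / 2)
    (Finset.Icc (-(K : ℤ)) K) hδ2
  let 𝒢 : (Finset.Icc (-(K : ℤ)) K → (π → Prop) → Prop × Prop) → Set (X → ℝ) := fun σ =>
    {f ∈ ℱ₀ | signature μ π (ε / 2) K f = σ}
  have h𝒢 : ∀ σ, IsEnvelope F (𝒢 σ) := fun σ =>
    ⟨hF.measurable, hF.nonneg, fun f hf => hF.abs_le f (hsub hf.1)⟩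
  let Θ : Set ((X → ℝ) × (X → ℝ)) :=
    (fun σ => (fun x => ⨅ f : 𝒢 σ, f.1 x, fun x => ⨆ f : 𝒢 σ, f.1 x)) ''
      {σ | (𝒢 σ).Nonempty}
  have hΘfin : Θ.Finite := (Set.toFinite _).image _
  have hΘ : IsBracketCover ε ℱ μ Θ := by
    constructor
    · rintro _ ⟨σ, ⟨f₀, hf₀⟩, rfl⟩
      refine isEpsBracket_iInf_iSup (hcount.mono (Set.sep_subset _ _))
        (fun f hf => hmeas f (hsub hf.1)) (h𝒢 σ) π hη K hf₀
        (fun f hf => hf.2.trans hf₀.2.symm) ?_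
      have hlt := hδint _ (lt_of_le_of_lt (measure_union_le _ _)
        ((ENNReal.add_lt_add hK (hπ f₀ (hsub hf₀.1))).trans_eq (ENNReal.add_halves δ)))
      calc _ ≤ ENNReal.ofReal (ε / 2) + ENNReal.ofReal (ε / 2) := by gcongr
        _ = ENNReal.ofReal ε := by rw [← ENNReal.ofReal_add hη.le hη.le, add_halves]
    · intro f hf
      obtain ⟨u, hu, hlim⟩ := happ f hf
      -- Some signature recurs infinitely often along `u`, which is enough to pass the bounds to the
      -- limit at every point.
      obtain ⟨σ, hσ⟩ : ∃ σ, ∃ᶠ n in atTop, signature μ π (ε / 2) K (u n) = σ := by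
        obtain ⟨σ, hσ⟩ := Finite.exists_infinite_fiber fun n => signature μ π (ε / 2) K (u n)
        exact ⟨σ, Nat.frequently_atTop_iff_infinite.2 (Set.infinite_coe_iff.1 hσ)⟩
      obtain ⟨n, hn⟩ := hσ.exists
      refine Set.mem_iUnion₂.2 ⟨_, ⟨σ, ⟨u n, hu n, hn⟩, rfl⟩, hmeas f hf, fun x => ?_, fun x => ?_⟩
      · exact ge_of_tendsto_of_frequently (hlim x)
          (hσ.mono fun m hm => ciInf_le ((h𝒢 σ).bddBelow x) ⟨u m, hu m, hm⟩)
      · exact le_of_tendsto_of_frequently (hlim x)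
          (hσ.mono fun m hm => le_ciSup ((h𝒢 σ).bddAbove x) ⟨u m, hu m, hm⟩)
  exact lt_of_le_of_lt (iInf₂_le Θ hΘ) hΘfin.encard_lt_top
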